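/- Let $0<Z\le \frac1e$ and let $n$ be a real number with $n\ge\max\{8e,\,16\log\frac1Z\}$. Put $\rho=1-\frac1n$, $$\operatorname{erf}(x)=\int_0^x e^{-s^2/2}\,ds,\qquad \tilde g(x)=\sqrt{\tfrac n8}\;Z\,\operatorname{erf}\!\Big(\tfrac{x}{\sqrt{8n}}\Big)e^{x^2/(16n)},\qquad g(x)=\min\{1,\max\{0,\tilde g(x)\}\},$$ let $U(n)=\tilde g^{-1}(1)$, i.e. $U(n)$ is the unique real number with $\tilde g(U(n))=1$, and assume $U(n)\ge 22$. The Discounted-Normal-Predictor with conservative updating, with parameters $\rho$ and $Z$, works as follows on real bits $b_1,\dots,b_T$. It starts from $x_1=0$. In round $t=1,\dots,T$ it predicts $g(x_t)$, receives $b_t$, and sets $x_{t+1}=\rho x_t+b_t$ if $x_t\in[0,U(n)]$, or $x_t<0$ and $b_t>0$, or $x_t>U(n)$ and $b_t<0$; otherwise it sets $x_{t+1}=\rho x_t$. Then, for every $T$ and every sequence $b_1,\dots,b_T$ of real numbers with $|b_t|\le1$ for all $t$, and for every $\eta$ with $\rho\le\eta<1$, $$\sum_{t=1}^T\eta^{T-t}g(x_t)b_t\;\ge\;-\frac{Z}{2(1-\eta)},$$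 and furthermore $$\sum_{t=1}^T\rho^{T-t}g(x_t)b_t\;\ge\;\sum_{t=1}^T\rho^{T-t}b_t-\frac{Z}{2(1-\rho)}-U(n)-1 .$$ Moreover, $U(n)=\tilde g^{-1}(1)\le\sqrt{16\,n\log\frac1Z}$. -/

import Mathlib

noncomputable section

namespace DNPcu

/-- The unnormalised error function `erf(x) = ∫₀ˣ exp(-s²/2) ds`. -/
def erf (x : ℝ) : ℝ := ∫ s in (0 : ℝ)..x, Real.exp (-s ^ 2 / 2)

/-- The unprojected confidence function
`g̃(x) = √(n/8) · Z · erf(x / √(8n)) · exp(x² / (16n))`. -/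
def gTilde (n Z x : ℝ) : ℝ :=
  Real.sqrt (n / 8) * Z * erf (x / Real.sqrt (8 * n)) * Real.exp (x ^ 2 / (16 * n))

/-- The confidence function: the projection of `g̃(x)` onto `[0, 1]`. -/
def g (n Z x : ℝ) : ℝ := max 0 (min (gTilde n Z x) 1)

/-- The threshold `U(n) = g̃⁻¹(1)`. For `n, Z > 0` the function `g̃` is a strictly increasing
bijection of the real line, so this is the unique solution of `g̃(x) = 1`. -/
def U (n Z : ℝ) : ℝ := Function.invFun (gTilde n Z) 1

/-- The window length `n = 1 / (1 - ρ)` that the algorithm computes from its input `ρ`. -/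
def window (ρ : ℝ) : ℝ := 1 / (1 - ρ)

/-- One conservative update of the deviation `x` on receiving the bit `b`. -/
def update (ρ Z x b : ℝ) : ℝ :=
  if (0 ≤ x ∧ x ≤ U (window ρ) Z) ∨ (x < 0 ∧ 0 < b) ∨ (U (window ρ) Z < x ∧ b < 0) then
    ρ * x + b
  else
    ρ * x

/-- The deviation `x_t` of the algorithm with inputs `ρ, Z` on the bits `b_1, b_2, …`.
Rounds are numbered from `1`, with `x_1 = 0`; the value at index `0` is never used. -/
def deviation (ρ Z : ℝ) (b : ℕ → ℝ) : ℕ → ℝ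
  | 0 => 0
  | 1 => 0
  | t + 2 => update ρ Z (deviation ρ Z b (t + 1)) (b (t + 1))

/-- The prediction `g(x_t)` of the algorithm in round `t`. -/
def prediction (ρ Z : ℝ) (b : ℕ → ℝ) (t : ℕ) : ℝ :=
  g (window ρ) Z (deviation ρ Z b t)

end DNPcu

end

namespace DNPcu

open MeasureTheory Set

/-! The proof is a potential argument with `potential`, Φ(x) = ∫₀ˣ g. The function `gTilde` solves
8g̃' = Z + x·g̃/n. A step from x in [0, U] to ρx + c with |c| ≤ 1 has increment c - x/n, of square
at most 4, so its second-order cost is at most 4g̃'(x) = Z/2 + x·g/(2n). The drift -x·g/n absorbs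
the last term and leaves -x·g/(2n), which is at most -Φ(x)/n by convexity. Hence Φ(ρx + c) ≤ ρΦ(x) +
g(x)c + Z/2 (`potential_step`, which also covers x outside [0, U]).

Since Φ ≥ 0 and η ≥ ρ, this telescopes to the first bound for the bits actually used; ignoring a bit
never raises g·b or g·b - b. The ρ-discounted sum of used bits is the deviation itself, which never
exceeds U + 1; this gives the second bound. -/

theorem hasDerivAt_erf (x : ℝ) : HasDerivAt erf (Real.exp (-x ^ 2 / 2)) x := by
  have hc : Continuous fun s : ℝ => Real.exp (-s ^ 2 / 2) := by fun_prop
  exact (hc.integral_hasStrictDerivAt 0 x).hasDerivAt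

theorem erf_zero : erf 0 = 0 := by simp [erf]

theorem erf_strictMono : StrictMono erf :=
  strictMono_of_hasDerivAt_pos hasDerivAt_erf fun _ => Real.exp_pos _

/-! ### Differential equation and convexity of `gTilde`. -/

/-- The derivative of `gTilde`, see `hasDerivAt_gTilde`. -/
noncomputable def gTildeDeriv (n Z x : ℝ) : ℝ := Z / 8 + x * gTilde n Z x / (8 * n)

/-- The Gaussian from differentiating `erf` at x/√(8n) cancels exp(x²/(16n)), leaving the constant
Z/8. -/
theorem hasDerivAt_gTilde {n : ℝ} (hn : 0 < n) (Z x : ℝ) :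
    HasDerivAt (gTilde n Z) (gTildeDeriv n Z x) x := by
  have h8 : (0 : ℝ) < Real.sqrt (8 * n) := Real.sqrt_pos.2 (by positivity)
  have h1 : HasDerivAt (fun y : ℝ => erf (y / Real.sqrt (8 * n)))
      (Real.exp (-(x / Real.sqrt (8 * n)) ^ 2 / 2) * (1 / Real.sqrt (8 * n))) x :=
    (hasDerivAt_erf _).comp x ((hasDerivAt_id x).div_const _)
  have h2 : HasDerivAt (fun y : ℝ => Real.exp (y ^ 2 / (16 * n)))
      (Real.exp (x ^ 2 / (16 * n)) * (2 * x / (16 * n))) x := by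
    have := ((hasDerivAt_pow 2 x).div_const (16 * n)).exp
    simpa using this
  have h3 := (h1.const_mul (Real.sqrt (n / 8) * Z)).mul h2
  refine h3.congr_deriv ?_
  have e1 : Real.exp (-(x / Real.sqrt (8 * n)) ^ 2 / 2) * Real.exp (x ^ 2 / (16 * n)) = 1 := by
    rw [← Real.exp_add, div_pow, Real.sq_sqrt (by positivity), Real.exp_eq_one_iff]
    field_simp
    ring
  have e2 : Real.sqrt (n / 8) * (1 / Real.sqrt (8 * n)) = 1 / 8 := by
    have : Real.sqrt (8 * n) = 8 * Real.sqrt (n / 8) := by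
      rw [show 8 * n = 8 ^ 2 * (n / 8) by ring, Real.sqrt_mul (by norm_num),
        Real.sqrt_sq (by norm_num)]
    rw [this] at h8 ⊢
    have : Real.sqrt (n / 8) ≠ 0 := by
      intro h; simp [h] at h8
    field_simp
  unfold gTildeDeriv gTilde
  calc _ = Z * (Real.sqrt (n / 8) * (1 / Real.sqrt (8 * n)))
          * (Real.exp (-(x / Real.sqrt (8 * n)) ^ 2 / 2) * Real.exp (x ^ 2 / (16 * n)))
        + x * (Real.sqrt (n / 8) * Z * erf (x / Real.sqrt (8 * n))
          * Real.exp (x ^ 2 / (16 * n))) / (8 * n) := by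
        field_simp
        ring
    _ = _ := by rw [e1, e2]; ring

theorem gTilde_zero (n Z : ℝ) : gTilde n Z 0 = 0 := by simp [gTilde, erf_zero]

theorem continuous_gTilde {n : ℝ} (hn : 0 < n) (Z : ℝ) : Continuous (gTilde n Z) :=
  continuous_iff_continuousAt.2 fun x => (hasDerivAt_gTilde hn Z x).continuousAt

theorem mul_gTilde_nonneg {n Z : ℝ} (hZ : 0 < Z) (x : ℝ) : 0 ≤ x * gTilde n Z x := by
  have h : 0 ≤ x * erf (x / Real.sqrt (8 * n)) := by
    rcases le_total 0 x with hx | hx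
    · refine mul_nonneg hx ?_
      rw [← erf_zero]
      exact erf_strictMono.monotone (by positivity)
    · refine mul_nonneg_of_nonpos_of_nonpos hx ?_
      rw [← erf_zero]
      exact erf_strictMono.monotone (div_nonpos_of_nonpos_of_nonneg hx (by positivity))
  have : x * gTilde n Z x = Real.sqrt (n / 8) * Z * (x * erf (x / Real.sqrt (8 * n)))
      * Real.exp (x ^ 2 / (16 * n)) := by unfold gTilde; ring
  rw [this]
  positivity

theorem gTildeDeriv_pos {n Z : ℝ} (hn : 0 < n) (hZ : 0 < Z) (x : ℝ) :
    0 < gTildeDeriv n Z x := by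
  have := mul_gTilde_nonneg (n := n) hZ x
  unfold gTildeDeriv
  positivity

theorem gTilde_strictMono {n Z : ℝ} (hn : 0 < n) (hZ : 0 < Z) : StrictMono (gTilde n Z) :=
  strictMono_of_hasDerivAt_pos (hasDerivAt_gTilde hn Z) (gTildeDeriv_pos hn hZ)

theorem gTilde_nonneg {n Z : ℝ} (hn : 0 < n) (hZ : 0 < Z) {x : ℝ} (hx : 0 ≤ x) :
    0 ≤ gTilde n Z x := by
  rw [← gTilde_zero n Z]
  exact (gTilde_strictMono hn hZ).monotone hx

theorem gTildeDeriv_mono {n Z : ℝ} (hn : 0 < n) (hZ : 0 < Z) {x y : ℝ} (hx : 0 ≤ x)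
    (hxy : x ≤ y) : gTildeDeriv n Z x ≤ gTildeDeriv n Z y := by
  have h1 := gTilde_nonneg hn hZ hx
  have h2 := (gTilde_strictMono hn hZ).monotone hxy
  have h3 := hx.trans hxy
  unfold gTildeDeriv
  gcongr

/-- `gTilde` lies above its tangents on the nonnegative half-line. -/
theorem gTilde_tangent_le {n Z : ℝ} (hn : 0 < n) (hZ : 0 < Z) {x s : ℝ} (hs : 0 ≤ s)
    (hsx : s ≤ x) : gTilde n Z x - gTildeDeriv n Z x * (x - s) ≤ gTilde n Z s := by
  have h := Convex.image_sub_le_mul_sub_of_deriv_le (convex_Icc s x) (f := gTilde n Z)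
    (continuous_gTilde hn Z).continuousOn
    (fun y _ => (hasDerivAt_gTilde hn Z y).differentiableAt.differentiableWithinAt)
    (C := gTildeDeriv n Z x)
    (fun y hy => by
      rw [interior_Icc] at hy
      rw [(hasDerivAt_gTilde hn Z y).deriv]
      exact gTildeDeriv_mono hn hZ (hs.trans hy.1.le) hy.2.le)
    s (left_mem_Icc.2 hsx) x (right_mem_Icc.2 hsx) hsx
  linarith

theorem gTilde_le_mul_deriv {n Z : ℝ} (hn : 0 < n) (hZ : 0 < Z) {x : ℝ} (hx : 0 ≤ x) :
    gTilde n Z x ≤ gTildeDeriv n Z x * x := by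
  have := gTilde_tangent_le hn hZ le_rfl hx
  rw [gTilde_zero] at this
  linarith

/-- Convexity and g̃(0) = 0 put the graph below its chord from the origin. -/
theorem mul_gTilde_le {n Z : ℝ} (hn : 0 < n) (hZ : 0 < Z) {x s : ℝ} (hs : 0 ≤ s)
    (hsx : s ≤ x) : x * gTilde n Z s ≤ s * gTilde n Z x := by
  have h1 := Convex.mul_sub_le_image_sub_of_le_deriv (convex_Icc s x) (f := gTilde n Z)
    (continuous_gTilde hn Z).continuousOn
    (fun y _ => (hasDerivAt_gTilde hn Z y).differentiableAt.differentiableWithinAt)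
    (C := gTildeDeriv n Z s)
    (fun y hy => by
      rw [interior_Icc] at hy
      rw [(hasDerivAt_gTilde hn Z y).deriv]
      exact gTildeDeriv_mono hn hZ hs hy.1.le)
    s (left_mem_Icc.2 hsx) x (right_mem_Icc.2 hsx) hsx
  have h2 := gTilde_le_mul_deriv hn hZ hs
  nlinarith [mul_le_mul_of_nonneg_left h1 hs, mul_le_mul_of_nonneg_right h2 (sub_nonneg.2 hsx)]

/-- The derivative has the sign of g̃ - r·g̃', nonpositive by convexity. This limits how fast g̃'
can grow. -/
theorem gTildeDeriv_exp_antitoneOn {n Z : ℝ} (hn : 0 < n) (hZ : 0 < Z) :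
    AntitoneOn (fun r => gTildeDeriv n Z r * Real.exp (-r ^ 2 / (8 * n))) (Ici 0) := by
  have hd : ∀ r, HasDerivAt (fun r => gTildeDeriv n Z r * Real.exp (-r ^ 2 / (8 * n)))
      ((gTilde n Z r - gTildeDeriv n Z r * r) / (8 * n) * Real.exp (-r ^ 2 / (8 * n))) r := by
    intro r
    have h1 : HasDerivAt (gTildeDeriv n Z)
        ((1 * gTilde n Z r + r * gTildeDeriv n Z r) / (8 * n)) r :=
      (((hasDerivAt_id r).mul (hasDerivAt_gTilde hn Z r)).div_const (8 * n)).const_add (Z / 8)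
    have h2 : HasDerivAt (fun r : ℝ => Real.exp (-r ^ 2 / (8 * n)))
        (Real.exp (-r ^ 2 / (8 * n)) * (-(2 * r) / (8 * n))) r := by
      have := ((hasDerivAt_pow 2 r).neg.div_const (8 * n)).exp
      simpa using this
    refine (h1.mul h2).congr_deriv ?_
    field_simp
    ring
  refine antitoneOn_of_deriv_nonpos (convex_Ici 0)
    (fun r _ => (hd r).continuousAt.continuousWithinAt)
    (fun r _ => (hd r).differentiableAt.differentiableWithinAt) fun r hr => ?_
  rw [interior_Ici] at hr
  rw [(hd r).deriv]
  have := gTilde_le_mul_deriv hn hZ (le_of_lt hr : (0 : ℝ) ≤ r)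
  exact mul_nonpos_of_nonpos_of_nonneg
    (div_nonpos_of_nonpos_of_nonneg (by linarith) (by positivity)) (Real.exp_pos _).le

theorem gTildeDeriv_le_two_mul {n Z : ℝ} (hn : 0 < n) (hZ : 0 < Z) {x r : ℝ} (hx : 0 ≤ x)
    (hxr : x ≤ r) (hr1 : r ≤ x + 1) (hrn : r ≤ n) :
    gTildeDeriv n Z r ≤ 2 * gTildeDeriv n Z x := by
  have h := gTildeDeriv_exp_antitoneOn hn hZ (mem_Ici.2 hx) (mem_Ici.2 (hx.trans hxr)) hxr
  have e : Real.exp (-r ^ 2 / (8 * n)) = Real.exp (-x ^ 2 / (8 * n))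
      * Real.exp (-((r - x) * (r + x)) / (8 * n)) := by
    rw [← Real.exp_add]
    congr 1
    ring
  -- Here r - x ≤ 1 and r + x ≤ 2n, so the exponent is at least -1/4.
  have hb : 1 / 2 ≤ Real.exp (-((r - x) * (r + x)) / (8 * n)) := by
    have h1 := Real.add_one_le_exp (-((r - x) * (r + x)) / (8 * n))
    have h2 : -(1 / 4) ≤ -((r - x) * (r + x)) / (8 * n) := by
      rw [le_div_iff₀ (by positivity)]
      nlinarith
    linarith
  have hp := gTildeDeriv_pos hn hZ r
  have hE := Real.exp_pos (-x ^ 2 / (8 * n))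
  simp only [e] at h
  have h3 : gTildeDeriv n Z r * Real.exp (-((r - x) * (r + x)) / (8 * n))
      ≤ gTildeDeriv n Z x := by
    refine le_of_mul_le_mul_right ?_ hE
    linarith
  nlinarith [mul_le_mul_of_nonneg_left hb hp.le]

/-! ### The threshold U. -/

/-- At this point the exponential factor is exactly 1/Z and the argument of `erf` is at least 1; erf
1 ≥ e^(-1/2) is offset by √(n/8) ≥ e^(1/2). -/
theorem one_le_gTilde {n Z : ℝ} (hZ0 : 0 < Z) (hZ : Z ≤ 1 / Real.exp 1)
    (hn : 8 * Real.exp 1 ≤ n) :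
    1 ≤ gTilde n Z (Real.sqrt (16 * n * Real.log (1 / Z))) := by
  have hn0 : 0 < n := lt_of_lt_of_le (by positivity) hn
  have hL : 1 ≤ Real.log (1 / Z) := by
    rw [Real.le_log_iff_exp_le (by positivity), le_div_iff₀ hZ0]
    rw [le_div_iff₀ (Real.exp_pos _)] at hZ
    linarith
  have h1 : Real.exp (Real.sqrt (16 * n * Real.log (1 / Z)) ^ 2 / (16 * n)) = 1 / Z := by
    rw [Real.sq_sqrt (by positivity), mul_div_cancel_left₀ _ (by positivity),
      Real.exp_log (by positivity)]
  have h2 : 1 ≤ Real.sqrt (16 * n * Real.log (1 / Z)) / Real.sqrt (8 * n) := by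
    rw [le_div_iff₀ (Real.sqrt_pos.2 (by positivity)), one_mul]
    refine Real.sqrt_le_sqrt ?_
    nlinarith
  have h3 : Real.exp (-1 / 2) ≤ erf 1 := by
    have hc : Continuous fun s : ℝ => Real.exp (-s ^ 2 / 2) := by fun_prop
    have := intervalIntegral.integral_mono_on (μ := volume) (a := 0) (b := 1) zero_le_one
      (f := fun _ => Real.exp (-1 / 2)) (g := fun s : ℝ => Real.exp (-s ^ 2 / 2))
      intervalIntegrable_const (hc.intervalIntegrable _ _) (fun s hs => by
        refine Real.exp_le_exp.2 ?_
        nlinarith [hs.1, hs.2])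
    simpa [erf] using this
  have h4 : Real.exp (1 / 2) ≤ Real.sqrt (n / 8) := by
    refine Real.le_sqrt_of_sq_le ?_
    rw [← Real.exp_nat_mul, le_div_iff₀ (by norm_num)]
    norm_num
    linarith
  have h5 := h3.trans (erf_strictMono.monotone h2)
  have h6 : 1 ≤ Real.sqrt (n / 8)
      * erf (Real.sqrt (16 * n * Real.log (1 / Z)) / Real.sqrt (8 * n)) := by
    calc (1 : ℝ) = Real.exp (1 / 2) * Real.exp (-1 / 2) := by
          rw [← Real.exp_add]; norm_num
      _ ≤ _ := by gcongr
  unfold gTilde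
  rw [h1]
  refine h6.trans (le_of_eq ?_)
  field_simp

theorem gTilde_U {n Z : ℝ} (hZ0 : 0 < Z) (hZ : Z ≤ 1 / Real.exp 1) (hn : 8 * Real.exp 1 ≤ n) :
    gTilde n Z (U n Z) = 1 := by
  have hn0 : 0 < n := lt_of_lt_of_le (by positivity) hn
  have h := intermediate_value_Icc (Real.sqrt_nonneg (16 * n * Real.log (1 / Z)))
    (continuous_gTilde hn0 Z).continuousOn
    (show (1 : ℝ) ∈ _ from ⟨by rw [gTilde_zero]; norm_num, one_le_gTilde hZ0 hZ hn⟩)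
  obtain ⟨x, -, hx⟩ := h
  -- `Function.invFun` is a true preimage only once the value 1 is known to be attained.
  exact Function.invFun_eq ⟨x, hx⟩

/-! ### The potential and its one-step inequality. -/

section Potential

variable {n Z : ℝ}

theorem continuous_g (hn : 0 < n) (Z : ℝ) : Continuous (g n Z) :=
  continuous_const.max ((continuous_gTilde hn Z).min continuous_const)

theorem g_nonneg (n Z x : ℝ) : 0 ≤ g n Z x := le_max_left _ _

theorem g_of_nonpos (hn : 0 < n) (hZ : 0 < Z) {x : ℝ} (hx : x ≤ 0) : g n Z x = 0 := by
  have h := (gTilde_strictMono hn hZ).monotone hx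
  rw [gTilde_zero] at h
  exact max_eq_left ((min_le_left _ _).trans h)

theorem g_of_mem (hn : 0 < n) (hZ : 0 < Z) (hU : gTilde n Z (U n Z) = 1) {x : ℝ}
    (hx : 0 ≤ x) (hxU : x ≤ U n Z) : g n Z x = gTilde n Z x := by
  have h := (gTilde_strictMono hn hZ).monotone hxU
  rw [hU] at h
  rw [g, min_eq_left h, max_eq_right (gTilde_nonneg hn hZ hx)]

theorem g_of_U_le (hn : 0 < n) (hZ : 0 < Z) (hU : gTilde n Z (U n Z) = 1) {x : ℝ}
    (hxU : U n Z ≤ x) : g n Z x = 1 := by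
  have h := (gTilde_strictMono hn hZ).monotone hxU
  rw [hU] at h
  rw [g, min_eq_right h, max_eq_right zero_le_one]

/-- The potential: the primitive of the confidence function that vanishes at `0`. -/
noncomputable def potential (n Z x : ℝ) : ℝ := ∫ s in (0 : ℝ)..x, g n Z s

theorem potential_sub (hn : 0 < n) (Z x y : ℝ) :
    potential n Z y - potential n Z x = ∫ s in x..y, g n Z s :=
  intervalIntegral.integral_interval_sub_left ((continuous_g hn Z).intervalIntegrable _ _)
    ((continuous_g hn Z).intervalIntegrable _ _)

theorem potential_zero (n Z : ℝ) : potential n Z 0 = 0 := by simp [potential]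

theorem potential_mono (hn : 0 < n) (Z : ℝ) : Monotone (potential n Z) := fun x y h => by
  have := intervalIntegral.integral_nonneg (μ := volume) h fun s _ => g_nonneg n Z s
  rw [← potential_sub hn] at this
  linarith

theorem potential_of_nonpos (hn : 0 < n) (hZ : 0 < Z) {x : ℝ} (hx : x ≤ 0) :
    potential n Z x = 0 := by
  have h : ∫ s in (0 : ℝ)..x, g n Z s = ∫ _ in (0 : ℝ)..x, (0 : ℝ) := by
    refine intervalIntegral.integral_congr fun s hs => ?_
    rw [uIcc_of_ge hx] at hs
    exact g_of_nonpos hn hZ hs.2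
  simpa [potential] using h

theorem potential_nonneg (hn : 0 < n) (hZ : 0 < Z) (x : ℝ) : 0 ≤ potential n Z x := by
  rcases le_total x 0 with hx | hx
  · exact (potential_of_nonpos hn hZ hx).ge
  · rw [← potential_zero n Z]
    exact potential_mono hn Z hx

theorem integral_affine (a m p x y : ℝ) :
    ∫ s in x..y, (a + m * (s - p)) = a * (y - x) + m / 2 * ((y - p) ^ 2 - (x - p) ^ 2) := by
  have hd : ∀ s ∈ uIcc x y, HasDerivAt (fun s => a * s + m / 2 * (s - p) ^ 2)
      (a + m * (s - p)) s := fun s _ => by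
    have h1 := (hasDerivAt_id s).const_mul a
    have h2 := (((hasDerivAt_id s).sub_const p).pow 2).const_mul (m / 2)
    refine (h1.add h2).congr_deriv ?_
    simp
    ring
  rw [intervalIntegral.integral_eq_sub_of_hasDerivAt hd
    (Continuous.intervalIntegrable (by fun_prop) _ _)]
  ring

theorem potential_sub_le_of_le (hn : 0 < n) (hZ : 0 < Z) (hU : gTilde n Z (U n Z) = 1)
    {x y : ℝ} (hx : 0 ≤ x) (hxU : x ≤ U n Z) (hyx : y ≤ x) :
    potential n Z y - potential n Z x
      ≤ g n Z x * (y - x) + gTildeDeriv n Z x / 2 * (y - x) ^ 2 := by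
  have h := intervalIntegral.integral_mono_on (μ := volume) hyx
    (f := fun s => g n Z x + gTildeDeriv n Z x * (s - x)) (g := g n Z)
    (Continuous.intervalIntegrable (by fun_prop) _ _)
    ((continuous_g hn Z).intervalIntegrable _ _) fun s hs => by
      rw [g_of_mem hn hZ hU hx hxU]
      rcases le_total 0 s with h0 | h0
      · rw [g_of_mem hn hZ hU h0 (hs.2.trans hxU)]
        linarith [gTilde_tangent_le hn hZ h0 hs.2]
      -- Left of 0 the tangent at x is nonpositive, hence still below g = 0.
      · rw [g_of_nonpos hn hZ h0]
        nlinarith [gTilde_le_mul_deriv hn hZ hx, gTildeDeriv_pos hn hZ x]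
  rw [integral_affine, ← potential_sub hn] at h
  linarith

theorem g_le_add_two_mul (hn : 0 < n) (hZ : 0 < Z) (hU : gTilde n Z (U n Z) = 1)
    (hUn : U n Z ≤ n) {x s : ℝ} (hx : 0 ≤ x) (hxs : x ≤ s) (hs1 : s ≤ x + 1)
    (hsU : s ≤ U n Z) :
    g n Z s ≤ g n Z x + 2 * gTildeDeriv n Z x * (s - x) := by
  rw [g_of_mem hn hZ hU hx (hxs.trans hsU), g_of_mem hn hZ hU (hx.trans hxs) hsU]
  have h := Convex.image_sub_le_mul_sub_of_deriv_le (convex_Icc x s) (f := gTilde n Z)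
    (continuous_gTilde hn Z).continuousOn
    (fun y _ => (hasDerivAt_gTilde hn Z y).differentiableAt.differentiableWithinAt)
    (C := 2 * gTildeDeriv n Z x)
    (fun y hy => by
      rw [interior_Icc] at hy
      rw [(hasDerivAt_gTilde hn Z y).deriv]
      exact gTildeDeriv_le_two_mul hn hZ hx hy.1.le (by linarith [hy.2]) (by linarith [hy.2]))
    x (left_mem_Icc.2 hxs) s (right_mem_Icc.2 hxs) hxs
  linarith

/-- Going up, the slope may double within unit distance, so the quadratic coefficient is twice that
of a downward step. -/
theorem potential_sub_le_of_ge (hn : 0 < n) (hZ : 0 < Z) (hU : gTilde n Z (U n Z) = 1)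
    (hUn : U n Z ≤ n) {x y : ℝ} (hx : 0 ≤ x) (hxU : x ≤ U n Z) (hxy : x ≤ y)
    (hy1 : y ≤ x + 1) :
    potential n Z y - potential n Z x
      ≤ g n Z x * (y - x) + gTildeDeriv n Z x * (y - x) ^ 2 := by
  have hp := gTildeDeriv_pos hn hZ x
  have h := intervalIntegral.integral_mono_on (μ := volume) hxy
    (g := fun s => g n Z x + 2 * gTildeDeriv n Z x * (s - x)) (f := g n Z)
    ((continuous_g hn Z).intervalIntegrable _ _)
    (Continuous.intervalIntegrable (by fun_prop) _ _) fun s hs => by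
      rcases le_total s (U n Z) with h0 | h0
      · exact g_le_add_two_mul hn hZ hU hUn hx hs.1 (hs.2.trans hy1) h0
      -- Beyond U, g stays at 1 while the increasing line has already reached 1 at U.
      · have := g_le_add_two_mul hn hZ hU hUn hx hxU (h0.trans (hs.2.trans hy1)) le_rfl
        rw [g_of_U_le hn hZ hU le_rfl] at this
        rw [g_of_U_le hn hZ hU h0]
        nlinarith
  rw [integral_affine, ← potential_sub hn] at h
  linarith

theorem potential_le (hn : 0 < n) (hZ : 0 < Z) (hU : gTilde n Z (U n Z) = 1) {x : ℝ}
    (hx : 0 ≤ x) (hxU : x ≤ U n Z) : potential n Z x ≤ x * g n Z x / 2 := by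
  rcases hx.eq_or_lt with rfl | hx0
  · simp [potential_zero]
  have h := intervalIntegral.integral_mono_on (μ := volume) hx
    (g := fun s => 0 + g n Z x / x * (s - 0)) (f := g n Z)
    ((continuous_g hn Z).intervalIntegrable _ _)
    (Continuous.intervalIntegrable (by fun_prop) _ _) fun s hs => by
      rw [g_of_mem hn hZ hU hx hxU, g_of_mem hn hZ hU hs.1 (hs.2.trans hxU)]
      have := mul_gTilde_le hn hZ hs.1 hs.2
      rw [zero_add, sub_zero, div_mul_eq_mul_div, le_div_iff₀ hx0]
      linarith
  rw [integral_affine] at h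
  refine h.trans (le_of_eq ?_)
  field_simp
  ring

theorem potential_of_U_le (hn : 0 < n) (hZ : 0 < Z) (hU : gTilde n Z (U n Z) = 1) {x : ℝ}
    (hxU : U n Z ≤ x) : potential n Z x = potential n Z (U n Z) + (x - U n Z) := by
  have h : ∫ s in (U n Z)..x, g n Z s = ∫ _ in (U n Z)..x, (1 : ℝ) := by
    refine intervalIntegral.integral_congr fun s hs => ?_
    rw [uIcc_of_le hxU] at hs
    exact g_of_U_le hn hZ hU hs.1
  rw [← potential_sub hn, intervalIntegral.integral_const, smul_eq_mul] at h
  linarith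

theorem potential_step_of_mem (hn : 0 < n) (hZ : 0 < Z) (hU : gTilde n Z (U n Z) = 1)
    (hUn : U n Z ≤ n) {x c : ℝ} (hx : 0 ≤ x) (hxU : x ≤ U n Z) (hc : |c| ≤ 1) :
    potential n Z ((1 - 1 / n) * x + c)
      ≤ (1 - 1 / n) * potential n Z x + g n Z x * c + Z / 2 := by
  obtain ⟨hc1, hc2⟩ := abs_le.1 hc
  have hxn0 : 0 ≤ x / n := by positivity
  have hxn1 : x / n ≤ 1 := (div_le_one hn).2 (hxU.trans hUn)
  have hy : (1 - 1 / n) * x + c - x = c - x / n := by ring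
  have hp := gTildeDeriv_pos hn hZ x
  have hmain : potential n Z ((1 - 1 / n) * x + c) - potential n Z x
      ≤ g n Z x * (c - x / n) + 4 * gTildeDeriv n Z x := by
    rcases le_total ((1 - 1 / n) * x + c) x with h | h
    · have h1 := potential_sub_le_of_le hn hZ hU hx hxU h
      rw [hy] at h1
      have : (c - x / n) ^ 2 ≤ 4 := by nlinarith
      nlinarith
    · have h1 := potential_sub_le_of_ge hn hZ hU hUn hx hxU h (by linarith)
      rw [hy] at h1
      have : (c - x / n) ^ 2 ≤ 4 := by nlinarith
      nlinarith
  have hle := potential_le hn hZ hU hx hxU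
  have hd : 4 * gTildeDeriv n Z x = Z / 2 + x * g n Z x / (2 * n) := by
    rw [g_of_mem hn hZ hU hx hxU, gTildeDeriv]
    field_simp
    ring
  have h2 : potential n Z x / n ≤ x * g n Z x / (2 * n) := by
    rw [div_le_div_iff₀ hn (by positivity)]
    nlinarith
  have e1 : (1 - 1 / n) * potential n Z x = potential n Z x - potential n Z x / n := by ring
  have e2 : g n Z x * (c - x / n) = g n Z x * c - 2 * (x * g n Z x / (2 * n)) := by
    field_simp
  linarith

/-- Above U the potential is affine with slope 1, so only a landing below U costs anything. It is
then expanded at U, and lies at most 1 + U/n ≤ 2 below it. -/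
theorem potential_step_of_gt (hn : 1 ≤ n) (hZ : 0 < Z) (hU : gTilde n Z (U n Z) = 1)
    (hU0 : 0 ≤ U n Z) (hUn : U n Z ≤ n) {x c : ℝ} (hxU : U n Z < x) (hc : -1 ≤ c) :
    potential n Z ((1 - 1 / n) * x + c)
      ≤ (1 - 1 / n) * potential n Z x + g n Z x * c + Z / 2 := by
  have hn0 : 0 < n := by linarith
  have hρ : 0 ≤ 1 - 1 / n := sub_nonneg.2 ((div_le_one hn0).2 hn)
  have hle := potential_le hn0 hZ hU hU0 le_rfl
  have hp := gTildeDeriv_pos hn0 hZ (U n Z)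
  have hd : 4 * gTildeDeriv n Z (U n Z) = Z / 2 + U n Z / n / 2 := by
    rw [gTildeDeriv, hU]
    field_simp
    ring
  have hUn1 : U n Z / n ≤ 1 := (div_le_one hn0).2 hUn
  have hUn0 : 0 ≤ U n Z / n := by positivity
  rw [g_of_U_le hn0 hZ hU le_rfl] at hle
  rw [g_of_U_le hn0 hZ hU hxU.le, potential_of_U_le hn0 hZ hU hxU.le]
  set y := (1 - 1 / n) * x + c with hy
  have hyU : potential n Z y ≤ potential n Z (U n Z) + (y - U n Z)
      + 2 * gTildeDeriv n Z (U n Z) := by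
    rcases le_total (U n Z) y with h | h
    · rw [potential_of_U_le hn0 hZ hU h]
      linarith
    · have h1 := potential_sub_le_of_le hn0 hZ hU hU0 le_rfl h
      rw [g_of_U_le hn0 hZ hU le_rfl] at h1
      have h2 : U n Z - U n Z / n ≤ (1 - 1 / n) * x := by
        have := mul_le_mul_of_nonneg_left hxU.le hρ
        have e : (1 - 1 / n) * U n Z = U n Z - U n Z / n := by ring
        linarith
      have : (y - U n Z) ^ 2 ≤ 4 := by nlinarith
      nlinarith
  have h3 : potential n Z (U n Z) / n ≤ U n Z / n / 2 := by
    rw [div_div, div_le_div_iff₀ hn0 (by positivity)]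
    nlinarith
  have e : (1 - 1 / n) * (potential n Z (U n Z) + (x - U n Z)) + 1 * c + Z / 2
      = potential n Z (U n Z) - potential n Z (U n Z) / n + (y - U n Z) + U n Z / n
        + Z / 2 := by
    rw [hy]; ring
  rw [e]
  linarith

/-- Monotonicity of the potential reduces this to a step from 0. -/
theorem potential_step_of_neg (hn : 1 ≤ n) (hZ : 0 < Z) (hU : gTilde n Z (U n Z) = 1)
    (hU0 : 0 ≤ U n Z) (hUn : U n Z ≤ n) {x c : ℝ} (hx : x < 0) (hc : |c| ≤ 1) :
    potential n Z ((1 - 1 / n) * x + c)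
      ≤ (1 - 1 / n) * potential n Z x + g n Z x * c + Z / 2 := by
  have hn0 : 0 < n := by linarith
  have hρ : 0 ≤ 1 - 1 / n := sub_nonneg.2 ((div_le_one hn0).2 hn)
  have h := potential_step_of_mem hn0 hZ hU hUn le_rfl hU0 hc
  have hm := potential_mono hn0 Z
    (show (1 - 1 / n) * x + c ≤ (1 - 1 / n) * 0 + c by nlinarith)
  rw [g_of_nonpos hn0 hZ le_rfl, potential_zero] at h
  rw [g_of_nonpos hn0 hZ hx.le, potential_of_nonpos hn0 hZ hx.le]
  linarith

end Potential

/-! ### Effect of ignoring bits in one round. -/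

/-- The bit that actually enters the conservative update: `b`, or `0` if it is ignored. -/
noncomputable def usedBit (n Z x b : ℝ) : ℝ :=
  if (0 ≤ x ∧ x ≤ U n Z) ∨ (x < 0 ∧ 0 < b) ∨ (U n Z < x ∧ b < 0) then b else 0

section Step

variable {n Z : ℝ}

theorem update_eq (ρ Z x b : ℝ) : update ρ Z x b = ρ * x + usedBit (window ρ) Z x b := by
  unfold update usedBit
  split_ifs <;> simp

theorem abs_usedBit_le {x b : ℝ} (hb : |b| ≤ 1) : |usedBit n Z x b| ≤ 1 := by
  unfold usedBit
  split_ifs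
  · exact hb
  · simp

theorem usedBit_nonpos {x b : ℝ} (hU0 : 0 ≤ U n Z) (hx : U n Z < x) : usedBit n Z x b ≤ 0 := by
  unfold usedBit
  split_ifs with h
  · rcases h with h | h | h
    · linarith [h.2]
    · linarith [h.1]
    · exact h.2.le
  · exact le_rfl

theorem potential_step (hn : 1 ≤ n) (hZ : 0 < Z) (hU : gTilde n Z (U n Z) = 1)
    (hU0 : 0 ≤ U n Z) (hUn : U n Z ≤ n) (x : ℝ) {b : ℝ} (hb : |b| ≤ 1) :
    potential n Z ((1 - 1 / n) * x + usedBit n Z x b)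
      ≤ (1 - 1 / n) * potential n Z x + g n Z x * usedBit n Z x b + Z / 2 := by
  have hc := abs_usedBit_le (n := n) (Z := Z) (x := x) hb
  rcases lt_or_ge x 0 with hx | hx
  · exact potential_step_of_neg hn hZ hU hU0 hUn hx hc
  · rcases lt_or_ge (U n Z) x with hxU | hxU
    · exact potential_step_of_gt hn hZ hU hU0 hUn hxU (abs_le.1 hc).1
    · exact potential_step_of_mem (by linarith) hZ hU hUn hx hxU hc

theorem g_mul_usedBit_le (hn : 0 < n) (hZ : 0 < Z) (x b : ℝ) :
    g n Z x * usedBit n Z x b ≤ g n Z x * b := by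
  unfold usedBit
  split_ifs with h
  · exact le_rfl
  · push Not at h
    rcases lt_or_ge x 0 with hx | hx
    · simp [g_of_nonpos hn hZ hx.le]
    · rw [mul_zero]
      exact mul_nonneg (g_nonneg _ _ _) (h.2.2 (h.1 hx))

/-- An ignored bit has either x < 0, g = 0 and b ≤ 0, or x > U and g = 1; in both cases (g - 1)b ≥
0. -/
theorem g_mul_sub_usedBit_le (hn : 0 < n) (hZ : 0 < Z) (hU : gTilde n Z (U n Z) = 1) (x b : ℝ) :
    g n Z x * usedBit n Z x b - usedBit n Z x b ≤ g n Z x * b - b := by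
  unfold usedBit
  split_ifs with h
  · exact le_rfl
  · push Not at h
    rcases lt_or_ge x 0 with hx | hx
    · have := h.2.1 hx
      rw [g_of_nonpos hn hZ hx.le]
      linarith
    · rw [g_of_U_le hn hZ hU (h.1 hx).le]
      linarith

/-- Only a step from x ≤ U can add a positive bit; above U the used bit is nonpositive. -/
theorem step_le (hn : 1 ≤ n) (hU0 : 0 ≤ U n Z) {x b : ℝ} (hb : |b| ≤ 1)
    (hx : x ≤ U n Z + 1) : (1 - 1 / n) * x + usedBit n Z x b ≤ U n Z + 1 := by
  have hn0 : 0 < n := by linarith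
  have hρ : 0 ≤ 1 - 1 / n := sub_nonneg.2 ((div_le_one hn0).2 hn)
  have hc := (abs_le.1 (abs_usedBit_le (n := n) (Z := Z) (x := x) hb)).2
  have h1 : 0 ≤ 1 / n := by positivity
  rcases lt_or_ge x 0 with hx0 | hx0
  · nlinarith
  · rcases lt_or_ge (U n Z) x with hxU | hxU
    · have := usedBit_nonpos (b := b) hU0 hxU
      nlinarith
    · nlinarith

end Step

theorem deviation_succ (ρ Z : ℝ) (b : ℕ → ℝ) (t : ℕ) :
    deviation ρ Z b (t + 2) = ρ * deviation ρ Z b (t + 1)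
      + usedBit (window ρ) Z (deviation ρ Z b (t + 1)) (b (t + 1)) := by
  rw [deviation, update_eq]

theorem sum_Icc_discounted_succ (η : ℝ) (f : ℕ → ℝ) (T : ℕ) :
    ∑ t ∈ Finset.Icc 1 (T + 1), η ^ (T + 1 - t) * f t
      = η * ∑ t ∈ Finset.Icc 1 T, η ^ (T - t) * f t + f (T + 1) := by
  rw [Finset.sum_Icc_succ_top (by omega), Finset.mul_sum]
  congr 1
  · refine Finset.sum_congr rfl fun t ht => ?_
    rw [Nat.succ_sub (Finset.mem_Icc.1 ht).2, pow_succ]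
    ring
  · simp

/-! ### Summation over the rounds. -/

section Rounds

variable {n Z : ℝ}

theorem window_one_sub (n : ℝ) : window (1 - 1 / n) = n := by simp [window]

theorem potential_le_discounted_sum (hn : 1 ≤ n) (hZ : 0 < Z) (hU : gTilde n Z (U n Z) = 1)
    (hU0 : 0 ≤ U n Z) (hUn : U n Z ≤ n) {η : ℝ} (hη : 1 - 1 / n ≤ η) (hη1 : η < 1)
    (b : ℕ → ℝ) (T : ℕ) (hb : ∀ t ∈ Finset.Icc 1 T, |b t| ≤ 1) :
    potential n Z (deviation (1 - 1 / n) Z b (T + 1)) - Z / (2 * (1 - η))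
      ≤ ∑ t ∈ Finset.Icc 1 T, η ^ (T - t) * (prediction (1 - 1 / n) Z b t
        * usedBit n Z (deviation (1 - 1 / n) Z b t) (b t)) := by
  have hn0 : 0 < n := by linarith
  have hη0 : 0 ≤ η := (sub_nonneg.2 ((div_le_one hn0).2 hn)).trans hη
  have h1η : 0 < 1 - η := by linarith
  induction T with
  | zero =>
    have : 0 ≤ Z / (2 * (1 - η)) := by positivity
    simpa [deviation, potential_zero] using this
  | succ T ih =>
    have ih := ih fun t ht => hb t (Finset.Icc_subset_Icc_right (Nat.le_succ T) ht)
    rw [sum_Icc_discounted_succ η (fun t => prediction (1 - 1 / n) Z b t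
        * usedBit n Z (deviation (1 - 1 / n) Z b t) (b t))]
    have hs := potential_step hn hZ hU hU0 hUn (deviation (1 - 1 / n) Z b (T + 1))
      (hb (T + 1) (by simp))
    have hd := deviation_succ (1 - 1 / n) Z b T
    rw [window_one_sub] at hd
    rw [← hd] at hs
    rw [prediction, window_one_sub]
    -- Nonnegativity of the potential lets the contraction ρ be weakened to any η ≥ ρ.
    have hP := mul_le_mul_of_nonneg_right hη
      (potential_nonneg hn0 hZ (deviation (1 - 1 / n) Z b (T + 1)))
    have hm := mul_le_mul_of_nonneg_left ih hη0
    -- Z/(2(1-η)) is the fixed point of a ↦ ηa + Z/2, the accumulated per-round loss.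
    have e : Z / (2 * (1 - η)) = η * (Z / (2 * (1 - η))) + Z / 2 := by
      field_simp
      ring
    linarith

theorem deviation_eq_discounted_sum (n Z : ℝ) (b : ℕ → ℝ) (T : ℕ) :
    ∑ t ∈ Finset.Icc 1 T, (1 - 1 / n) ^ (T - t)
        * usedBit n Z (deviation (1 - 1 / n) Z b t) (b t)
      = deviation (1 - 1 / n) Z b (T + 1) := by
  induction T with
  | zero => simp [deviation]
  | succ T ih =>
    rw [sum_Icc_discounted_succ (1 - 1 / n)
      (fun t => usedBit n Z (deviation (1 - 1 / n) Z b t) (b t)), ih, deviation_succ,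
      window_one_sub]

theorem deviation_le (hn : 1 ≤ n) (hU0 : 0 ≤ U n Z) (b : ℕ → ℝ) (T : ℕ)
    (hb : ∀ t ∈ Finset.Icc 1 T, |b t| ≤ 1) :
    deviation (1 - 1 / n) Z b (T + 1) ≤ U n Z + 1 := by
  induction T with
  | zero => simp only [deviation]; linarith
  | succ T ih =>
    rw [deviation_succ, window_one_sub]
    exact step_le hn hU0 (hb (T + 1) (by simp))
      (ih fun t ht => hb t (Finset.Icc_subset_Icc_right (Nat.le_succ T) ht))

end Rounds

end DNPcu

/-! ### Assembly of the bounds. -/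

open DNPcu in
theorem theorem2 (Z n ρ : ℝ) (hZ0 : 0 < Z) (hZ : Z ≤ 1 / Real.exp 1)
    (hn : max (8 * Real.exp 1) (16 * Real.log (1 / Z)) ≤ n)
    (hU : 22 ≤ DNPcu.U n Z) (hρ : ρ = 1 - 1 / n) :
    (∀ (T : ℕ) (b : ℕ → ℝ), (∀ t ∈ Finset.Icc 1 T, |b t| ≤ 1) →
      (∀ η : ℝ, ρ ≤ η → η < 1 →
        ∑ t ∈ Finset.Icc 1 T, η ^ (T - t) * DNPcu.prediction ρ Z b t * b t
          ≥ -(Z / (2 * (1 - η)))) ∧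
      ∑ t ∈ Finset.Icc 1 T, ρ ^ (T - t) * DNPcu.prediction ρ Z b t * b t
        ≥ ∑ t ∈ Finset.Icc 1 T, ρ ^ (T - t) * b t
          - Z / (2 * (1 - ρ)) - DNPcu.U n Z - 1) ∧
    (∀ x : ℝ, DNPcu.gTilde n Z x = 1 ↔ x = DNPcu.U n Z) ∧
    DNPcu.U n Z ≤ Real.sqrt (16 * n * Real.log (1 / Z)) := by
  subst hρ
  have hn8 := (le_max_left _ _).trans hn
  have hnL := (le_max_right _ _).trans hn
  have hn1 : 1 ≤ n := by linarith [Real.add_one_le_exp 1]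
  have hn0 : 0 < n := by linarith
  have hU0 : 0 ≤ U n Z := by linarith
  have hg := gTilde_U hZ0 hZ hn8
  have hUle : U n Z ≤ Real.sqrt (16 * n * Real.log (1 / Z)) := by
    rw [← (gTilde_strictMono hn0 hZ0).le_iff_le, hg]
    exact one_le_gTilde hZ0 hZ hn8
  -- From 16 log(1/Z) ≤ n, the radicand is at most n².
  have hUn : U n Z ≤ n := hUle.trans (Real.sqrt_le_iff.2 ⟨hn0.le, by nlinarith⟩)
  have hρ0 : 0 ≤ 1 - 1 / n := sub_nonneg.2 ((div_le_one hn0).2 hn1)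
  have hρ1 : 1 - 1 / n < 1 := by
    have : 0 < 1 / n := by positivity
    linarith
  refine ⟨fun T b hb => ⟨fun η hη hη1 => ?_, ?_⟩, fun x => ?_, hUle⟩
  · have h1 := potential_le_discounted_sum hn1 hZ0 hg hU0 hUn hη hη1 b T hb
    have h2 := potential_nonneg hn0 hZ0 (deviation (1 - 1 / n) Z b (T + 1))
    have h3 : ∑ t ∈ Finset.Icc 1 T, η ^ (T - t) * (prediction (1 - 1 / n) Z b t
        * usedBit n Z (deviation (1 - 1 / n) Z b t) (b t))
        ≤ ∑ t ∈ Finset.Icc 1 T, η ^ (T - t) * prediction (1 - 1 / n) Z b t * b t := by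
      refine Finset.sum_le_sum fun t _ => ?_
      rw [mul_assoc, prediction, window_one_sub]
      exact mul_le_mul_of_nonneg_left (g_mul_usedBit_le hn0 hZ0 _ _)
        (pow_nonneg (hρ0.trans hη) _)
    linarith
  · have h1 := potential_le_discounted_sum hn1 hZ0 hg hU0 hUn le_rfl hρ1 b T hb
    have h2 := potential_nonneg hn0 hZ0 (deviation (1 - 1 / n) Z b (T + 1))
    have h3 : ∑ t ∈ Finset.Icc 1 T, (1 - 1 / n) ^ (T - t) * (prediction (1 - 1 / n) Z b t
          * usedBit n Z (deviation (1 - 1 / n) Z b t) (b t))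
        - ∑ t ∈ Finset.Icc 1 T, (1 - 1 / n) ^ (T - t)
          * usedBit n Z (deviation (1 - 1 / n) Z b t) (b t)
        ≤ ∑ t ∈ Finset.Icc 1 T, (1 - 1 / n) ^ (T - t) * prediction (1 - 1 / n) Z b t * b t
          - ∑ t ∈ Finset.Icc 1 T, (1 - 1 / n) ^ (T - t) * b t := by
      rw [← Finset.sum_sub_distrib, ← Finset.sum_sub_distrib]
      refine Finset.sum_le_sum fun t _ => ?_
      rw [mul_assoc, prediction, window_one_sub, ← mul_sub, ← mul_sub]
      exact mul_le_mul_of_nonneg_left (g_mul_sub_usedBit_le hn0 hZ0 hg _ _)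
        (pow_nonneg hρ0 _)
    rw [deviation_eq_discounted_sum] at h3
    have h4 := deviation_le hn1 hU0 b T hb
    linarith
  · rw [← hg]
    exact (gTilde_strictMono hn0 hZ0).injective.eq_iff
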